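/- Let $d \ge 3$ and $q \ge 2$ be integers, and let $l_1, \dots, l_{d-1} \in \mathbb{Z}_q = \mathbb{Z}/q\mathbb{Z}$ be elements with $l_1 = 0$ such that $l_i - l_j$ is invertible in $\mathbb{Z}_q$ whenever $i \ne j$. (Such elements exist if and only if $d \le p+1$ for every prime $p$ dividing $q$.) Let $$\mathcal{R}_d(\mathbb{Z}_q) = \mathbb{Z}_q\big[t, (t+l_1)^{-1}, \dots, (t+l_{d-1})^{-1}\big],$$ and let the Diestel-Leader group $\Gamma_d(q)$ be the group, under matrix multiplication, of all matrices $$\begin{pmatrix} (t+l_1)^{k_1} \cdots (t+l_{d-1})^{k_{d-1}} & P \\ 0 & 1 \end{pmatrix}, \qquad k_1, \dots, k_{d-1} \in \mathbb{Z},\quad P \in \mathcal{R}_d(\mathbb{Z}_q).$$ Then $\Gamma_d(q)$ has property $R_\infty$: for every automorphism $\varphi$ of $\Gamma_d(q)$ there are infinitely many $\varphi$-twisted conjugacy classes, that is, infinitely many classes of the equivalence relation on $\Gamma_d(q)$ under which $g$ and $h$ are equivalent if and only if $s g \varphi(s)^{-1} = h$ for some $s \in \Gamma_d(q)$. -/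

import Mathlib

namespace DiestelLeader

noncomputable section

open Polynomial

/-- The submonoid of `L[t]` generated by the polynomials `t + l i`. -/
def denominators {L : Type*} [CommRing L] {ι : Type*} (l : ι → L) : Submonoid L[X] :=
  Submonoid.closure (Set.range fun i => (X + C (l i) : L[X]))

/-- The ring `L[t, (t + l i)⁻¹ : i ∈ ι]`, obtained from the polynomial ring `L[t]` by inverting
the polynomials `t + l i`.  These are monic, hence not zero divisors, so `L[t]` embeds in it. -/
def CoeffRing {L : Type*} [CommRing L] {ι : Type*} (l : ι → L) : Type _ :=
  Localization (denominators l)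

instance {L : Type*} [CommRing L] {ι : Type*} (l : ι → L) : CommRing (CoeffRing l) :=
  inferInstanceAs (CommRing (Localization (denominators l)))

instance {L : Type*} [CommRing L] {ι : Type*} (l : ι → L) : Algebra L[X] (CoeffRing l) :=
  inferInstanceAs (Algebra L[X] (Localization (denominators l)))

instance {L : Type*} [CommRing L] {ι : Type*} (l : ι → L) :
    IsLocalization (denominators l) (CoeffRing l) :=
  inferInstanceAs (IsLocalization (denominators l) (Localization (denominators l)))

/-- The element `t + l i`, as a unit of `L[t, (t + l i)⁻¹ : i ∈ ι]`. -/
def lin {L : Type*} [CommRing L] {ι : Type*} (l : ι → L) (i : ι) : (CoeffRing l)ˣ :=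
  (IsLocalization.map_units (CoeffRing l)
    (⟨X + C (l i), Submonoid.subset_closure ⟨i, rfl⟩⟩ : denominators l)).unit

theorem coe_lin {L : Type*} [CommRing L] {ι : Type*} (l : ι → L) (i : ι) :
    (lin l i : CoeffRing l) = algebraMap L[X] (CoeffRing l) (X + C (l i)) :=
  rfl

/-- The monomial `∏ i, (t + l i) ^ (k i)` with integer exponents `k i`. -/
def linMonomial {L : Type*} [CommRing L] {ι : Type*} [Fintype ι] (l : ι → L) (k : ι → ℤ) :
    (CoeffRing l)ˣ :=
  ∏ i, lin l i ^ k i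

theorem linMonomial_zero {L : Type*} [CommRing L] {ι : Type*} [Fintype ι] (l : ι → L) :
    linMonomial l 0 = 1 := by
  simp [linMonomial]

theorem linMonomial_add {L : Type*} [CommRing L] {ι : Type*} [Fintype ι] (l : ι → L)
    (k m : ι → ℤ) : linMonomial l (k + m) = linMonomial l k * linMonomial l m := by
  simp [linMonomial, zpow_add, Finset.prod_mul_distrib]

theorem linMonomial_neg {L : Type*} [CommRing L] {ι : Type*} [Fintype ι] (l : ι → L)
    (k : ι → ℤ) : linMonomial l (-k) = (linMonomial l k)⁻¹ := by
  simp [linMonomial]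

/-- The group of all matrices
`[∏ i, (t + l i) ^ (k i), P; 0, 1]`, with integers `k i` and `P ∈ L[t, (t + l i)⁻¹ : i ∈ ι]`,
under matrix multiplication. -/
def matrixGroup {L : Type*} [CommRing L] {ι : Type*} [Fintype ι] (l : ι → L) :
    Subgroup (GL (Fin 2) (CoeffRing l)) where
  carrier := {g | ∃ (k : ι → ℤ) (P : CoeffRing l),
    (g : Matrix (Fin 2) (Fin 2) (CoeffRing l)) = !![(linMonomial l k : CoeffRing l), P; 0, 1]}
  one_mem' := ⟨0, 0, by rw [linMonomial_zero]; simp [Matrix.one_fin_two]⟩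
  mul_mem' := by
    rintro a b ⟨k, P, ha⟩ ⟨m, Q, hb⟩
    refine ⟨k + m, (linMonomial l k : CoeffRing l) * Q + P, ?_⟩
    rw [Units.val_mul, ha, hb, linMonomial_add, Matrix.mul_fin_two]
    simp
  inv_mem' := by
    rintro a ⟨k, P, ha⟩
    refine ⟨-k, -((((linMonomial l k)⁻¹ : (CoeffRing l)ˣ) : CoeffRing l) * P), ?_⟩
    refine Units.inv_eq_of_mul_eq_one_right ?_
    rw [ha, linMonomial_neg, Matrix.mul_fin_two, Matrix.one_fin_two]
    simp

/-- The Diestel-Leader group `Γ_d(q)` with coefficient ring `ℤ/qℤ` and parameters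
`l_1, …, l_{d-1}`. -/
abbrev Gam (d q : ℕ) (l : Fin (d - 1) → ZMod q) : Type :=
  matrixGroup l

/-- `g` and `h` are `φ`-twisted conjugate if `s * g * (φ s)⁻¹ = h` for some `s`. -/
def twistedConj {G : Type*} [Group G] (φ : MulAut G) : Setoid G where
  r g h := ∃ s : G, s * g * (φ s)⁻¹ = h
  iseqv :=
    { refl := fun g => ⟨1, by simp⟩
      symm := by
        rintro g h ⟨s, rfl⟩
        exact ⟨s⁻¹, by simp [mul_assoc]⟩
      trans := by
        rintro g h k ⟨s, rfl⟩ ⟨r, rfl⟩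
        exact ⟨r * s, by simp [mul_assoc]⟩ }

/-- Property `R_∞`: each automorphism has infinitely many twisted conjugacy classes. -/
def PropertyRInf (G : Type*) [Group G] : Prop :=
  ∀ φ : MulAut G, Infinite (Quotient (twistedConj φ))

end

end DiestelLeader

namespace DiestelLeader

open Polynomial

/-! ### Valuations and additive generators of the coefficient ring. -/

section CoeffRing

variable {L : Type*} [CommRing L] {ι : Type*} (l : ι → L)

/-! The unipotent matrices are exactly the torsion elements, so an automorphism `φ` preserves them
and induces an automorphism `A` of the exponent lattice `ι → ℤ`. On unipotent entries it has the
form `P ↦ ψ P * c`, with `ψ` a ring endomorphism and `c` a unit (`exists_semilinear`).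

Since `ψ` fixes constants, the elements `ψ (t + l i)` differ pairwise by unit constants. Valuations
at the roots then force each coordinate of `A k` to be some `k i` or `-∑ i, k i`, the valuation at
infinity (`exists_column_type`). This is recorded by an injection `T : ι → Option ι`.

If `T` avoids `none`, it permutes the coordinates and their sum is invariant; if `T m = some m`,
coordinate `m` is invariant. An invariant functional separates infinitely many classes
(`infinite_of_invariant`). Otherwise, comparing coefficients in the images of the `t + l i` leaves
only `q = 2` with two parameters and `A` of order three. There the orbit sums of monomials under `ψ`
give infinitely many classes (`infinite_of_order_three`). -/

theorem denominators_le_nonZeroDivisors : denominators l ≤ nonZeroDivisors L[X] := by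
  refine (Submonoid.closure_le).2 ?_
  rintro _ ⟨i, rfl⟩
  exact (monic_X_add_C (l i)).mem_nonZeroDivisors

theorem algebraMap_injective : Function.Injective (algebraMap L[X] (CoeffRing l)) :=
  IsLocalization.injective _ (denominators_le_nonZeroDivisors l)

theorem exists_coeffRing_lift {S : Type*} [CommRing S] (g : L[X] →+* S)
    (hg : ∀ i, IsUnit (g (X + C (l i)))) :
    ∃ η : CoeffRing l →+* S, ∀ f, η (algebraMap L[X] (CoeffRing l) f) = g f := by
  have h : ∀ y : denominators l, IsUnit (g y) := by
    rintro ⟨y, hy⟩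
    change y ∈ (IsUnit.submonoid S).comap (g : L[X] →* S)
    refine (Submonoid.closure_le.2 ?_) hy
    rintro _ ⟨i, rfl⟩
    exact hg i
  exact ⟨IsLocalization.lift h, IsLocalization.lift_eq h⟩

theorem lin_sub_lin (i j : ι) : (lin l i : CoeffRing l) - lin l j =
    algebraMap L[X] (CoeffRing l) (C (l i - l j)) := by
  rw [coe_lin, coe_lin, ← map_sub, C_sub]
  ring_nf

variable [Fintype ι]

theorem linMonomial_single [DecidableEq ι] (i : ι) (n : ℤ) :
    linMonomial l (Pi.single i n) = lin l i ^ n := by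
  rw [linMonomial, Finset.prod_eq_single i]
  · simp
  · intro j _ hj
    simp [hj]
  · simp

theorem exists_linMonomial_of_mem_denominators {f : L[X]} (hf : f ∈ denominators l) :
    ∃ k : ι → ℤ, (linMonomial l k : CoeffRing l) = algebraMap L[X] (CoeffRing l) f := by
  classical
  induction hf using Submonoid.closure_induction with
  | mem x hx =>
    obtain ⟨i, rfl⟩ := hx
    exact ⟨Pi.single i 1, by rw [linMonomial_single, zpow_one, coe_lin]⟩
  | one => exact ⟨0, by simp [linMonomial_zero]⟩
  | mul x y _ _ hx hy =>
    obtain ⟨k, hk⟩ := hx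
    obtain ⟨m, hm⟩ := hy
    exact ⟨k + m, by rw [linMonomial_add, Units.val_mul, hk, hm, map_mul]⟩

theorem exists_eq_mul_linMonomial (x : CoeffRing l) :
    ∃ (f : L[X]) (k : ι → ℤ), x = algebraMap L[X] (CoeffRing l) f * linMonomial l k := by
  obtain ⟨⟨f, s, hs⟩, h⟩ := IsLocalization.surj (denominators l) x
  obtain ⟨k, hk⟩ := exists_linMonomial_of_mem_denominators l hs
  refine ⟨f, -k, ?_⟩
  rw [linMonomial_neg, Units.eq_mul_inv_iff_mul_eq, hk]
  exact h

/-- The valuation of `L[t, (t + l i)⁻¹]` at the root of `t + l m` in a residue field of `L`. -/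
theorem exists_addValuation {K : Type*} [Field K] (h : L →+* K)
    (hl : ∀ i j, i ≠ j → h (l i) ≠ h (l j)) (m : ι) :
    ∃ v : AddValuation (CoeffRing l) (WithTop ℤ),
      (∀ k : ι → ℤ, v (linMonomial l k) = (k m : ℤ)) ∧
      ∀ c : L, h c ≠ 0 → v (algebraMap L[X] (CoeffRing l) (C c)) = (0 : ℤ) := by
  classical
  -- Laurent expansion at the root: with `u` the variable, `t ↦ u - h (l m)`, so `t + l i` has order
  -- 1 for `i = m` and is a unit power series otherwise.
  set g : L[X] →+* HahnSeries ℤ K := eval₂RingHom (HahnSeries.C.comp h)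
    (HahnSeries.single 1 1 - HahnSeries.C (h (l m))) with hg
  have hgC : ∀ c, g (C c) = HahnSeries.C (h c) := fun c => by simp [hg]
  have hglin : ∀ i, g (X + C (l i)) =
      HahnSeries.single 1 1 + HahnSeries.C (h (l i) - h (l m)) := fun i => by
    simp [hg]; ring
  have hX : HahnSeries.addVal ℤ K (HahnSeries.single 1 1) = (1 : ℤ) := by
    rw [HahnSeries.addVal_apply_of_ne (by simp), HahnSeries.order_single one_ne_zero]
  have hCv : ∀ c : K, c ≠ 0 → HahnSeries.addVal ℤ K (HahnSeries.C c) = (0 : ℤ) := fun c hc => by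
    rw [HahnSeries.addVal_apply_of_ne (HahnSeries.C_ne_zero hc), HahnSeries.order_C]
  have hval : ∀ i, HahnSeries.addVal ℤ K (g (X + C (l i))) =
      (((if i = m then 1 else 0 : ℤ)) : WithTop ℤ) := by
    intro i
    rw [hglin]
    split_ifs with him
    · subst him
      simp
    · have := hCv _ (sub_ne_zero.2 (hl i m him))
      rw [AddValuation.map_add_eq_of_lt_right, this]
      rw [this, hX]
      exact WithTop.coe_lt_coe.2 zero_lt_one
  have hne : ∀ i, g (X + C (l i)) ≠ 0 := by
    intro i h0
    have := hval i
    rw [h0, AddValuation.map_zero] at this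
    exact WithTop.top_ne_coe this
  obtain ⟨η, hη⟩ := exists_coeffRing_lift l g fun i => (hne i).isUnit
  let w : (CoeffRing l)ˣ →* Multiplicative ℤ :=
    { toFun := fun u => Multiplicative.ofAdd (η u).order
      map_one' := by simp
      map_mul' := fun a b => by
        rw [Units.val_mul, map_mul, HahnSeries.order_mul (a.isUnit.map η).ne_zero
          (b.isUnit.map η).ne_zero, ofAdd_add] }
  have hw : ∀ u : (CoeffRing l)ˣ,
      HahnSeries.addVal ℤ K (η u) = ((w u).toAdd : ℤ) := fun u =>
    HahnSeries.addVal_apply_of_ne (u.isUnit.map η).ne_zero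
  have hwlin : ∀ i, w (lin l i) = Multiplicative.ofAdd (if i = m then 1 else 0 : ℤ) := by
    intro i
    have := hw (lin l i)
    rw [coe_lin, hη, hval] at this
    exact (congrArg Multiplicative.ofAdd (WithTop.coe_injective this)).symm
  refine ⟨(HahnSeries.addVal ℤ K).comap η, fun k => ?_, fun c hc => ?_⟩
  · change HahnSeries.addVal ℤ K (η _) = _
    rw [hw, linMonomial, map_prod, Finset.prod_eq_single m]
    · simp [hwlin]
    · intro j _ hj
      simp [hwlin, hj]
    · simp
  · change HahnSeries.addVal ℤ K (η _) = _
    rw [hη, hgC, hCv _ hc]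

theorem linMonomial_injective {K : Type*} [Field K] (h : L →+* K)
    (hl : ∀ i j, i ≠ j → h (l i) ≠ h (l j)) : Function.Injective (linMonomial l) := by
  intro k k' hk
  funext m
  obtain ⟨v, hv, -⟩ := exists_addValuation l h hl m
  exact WithTop.coe_injective ((hv k).symm.trans ((congrArg (fun u => v (Units.val u)) hk).trans
    (hv k')))

/-- The monomials span `L[t, (t + l i)⁻¹]` additively if `L` is a quotient of `ℤ`. -/
theorem linMonomial_induction (hL : Function.Surjective (Int.cast : ℤ → L)) (i₀ : ι)
    (h₀ : l i₀ = 0) {p : CoeffRing l → Prop} (hmon : ∀ k, p (linMonomial l k)) (hzero : p 0)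
    (hadd : ∀ x y, p x → p y → p (x + y)) (hneg : ∀ x, p x → p (-x)) (x : CoeffRing l) : p x := by
  classical
  let H : AddSubgroup (CoeffRing l) :=
    { carrier := {x | p x}
      zero_mem' := hzero
      add_mem' := fun {a b} => hadd a b
      neg_mem' := fun {a} => hneg a }
  obtain ⟨f, k, rfl⟩ := exists_eq_mul_linMonomial l x
  change _ ∈ H
  induction f using Polynomial.induction_on with
  | C a =>
    obtain ⟨n, rfl⟩ := hL a
    have := H.zsmul_mem (hmon k : (linMonomial l k : CoeffRing l) ∈ H) n
    simpa using this
  | add f g hf hg =>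
    rw [map_add, add_mul]
    exact H.add_mem hf hg
  | monomial n a _ =>
    obtain ⟨z, rfl⟩ := hL a
    -- Since `l i₀ = 0`, the powers of `t` are themselves monomials.
    have hX : (algebraMap L[X] (CoeffRing l) (X ^ (n + 1))) =
        linMonomial l (Pi.single i₀ ((n + 1 : ℕ) : ℤ)) := by
      rw [linMonomial_single, zpow_natCast, Units.val_pow_eq_pow_val, coe_lin, h₀, map_zero,
        add_zero, map_pow]
    rw [map_mul, hX, mul_assoc, ← Units.val_mul, ← linMonomial_add]
    have hmem : (linMonomial l (Pi.single i₀ ((n + 1 : ℕ) : ℤ) + k) : CoeffRing l) ∈ H := hmon _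
    have := H.zsmul_mem hmem z
    simpa using this

end CoeffRing

/-! ### Units of the coefficient ring over the field with two elements. -/

section Units

variable {K : Type*} [Field K] {ι : Type*} (l : ι → K)

/-- The factors `t + l i` are prime, so by unique factorization a divisor of their product is a
subproduct up to a constant unit, and the only such unit is 1. -/
theorem mem_denominators_of_mul (hK : ∀ a : K, a ≠ 0 → a = 1) {s : K[X]}
    (hs : s ∈ denominators l) : ∀ f g, f * g = s → f ∈ denominators l := by
  induction hs using Submonoid.closure_induction_left with
  | one =>
    intro f g h
    obtain ⟨a, ha, rfl⟩ := Polynomial.isUnit_iff.1 (IsUnit.of_mul_eq_one g h)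
    rw [hK a ha.ne_zero, C_1]
    exact one_mem _
  | mul_left x hx y hy ih =>
    obtain ⟨i, rfl⟩ := hx
    intro f g h
    have hp : Prime (X + C (l i)) := by simpa using prime_X_sub_C (-(l i))
    rcases hp.dvd_or_dvd ((Dvd.intro y h.symm : X + C (l i) ∣ f * g)) with ⟨f', rfl⟩ | ⟨g', rfl⟩
    · refine mul_mem (Submonoid.subset_closure ⟨i, rfl⟩) (ih f' g ?_)
      exact mul_left_cancel₀ hp.ne_zero (by rw [← h]; ring)
    · exact ih f g' (mul_left_cancel₀ hp.ne_zero (by rw [← h]; ring))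

theorem exists_linMonomial_eq_unit [Fintype ι] (hK : ∀ a : K, a ≠ 0 → a = 1)
    (u : (CoeffRing l)ˣ) : ∃ k : ι → ℤ, linMonomial l k = u := by
  obtain ⟨⟨f, s, hs⟩, h⟩ := IsLocalization.surj (denominators l) (u : CoeffRing l)
  obtain ⟨⟨g, r, hr⟩, h'⟩ := IsLocalization.surj (denominators l) ((u⁻¹ : (CoeffRing l)ˣ) : CoeffRing l)
  dsimp only at h h'
  have hfg : f * g = s * r := by
    apply algebraMap_injective l
    rw [map_mul, map_mul, ← h, ← h', mul_mul_mul_comm, Units.mul_inv, one_mul]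
  obtain ⟨k, hk⟩ := exists_linMonomial_of_mem_denominators l
    (mem_denominators_of_mul l hK (mul_mem hs hr) f g hfg)
  obtain ⟨m, hm⟩ := exists_linMonomial_of_mem_denominators l hs
  refine ⟨k - m, Units.ext ?_⟩
  rw [sub_eq_add_neg, linMonomial_add, linMonomial_neg, Units.val_mul, Units.mul_inv_eq_iff_eq_mul,
    hk, hm, h]

end Units

/-! ### Automorphisms of the matrix group. -/

section MatrixGroup

variable {L : Type*} [CommRing L] {ι : Type*} [Fintype ι] (l : ι → L)

/-- The matrix `[∏ i, (t + l i) ^ (k i), P; 0, 1]`. -/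
noncomputable def affine (k : ι → ℤ) (P : CoeffRing l) : matrixGroup l :=
  ⟨⟨!![(linMonomial l k : CoeffRing l), P; 0, 1],
    !![((linMonomial l k)⁻¹ : (CoeffRing l)ˣ), -(((linMonomial l k)⁻¹ : (CoeffRing l)ˣ) * P); 0, 1],
    by rw [Matrix.mul_fin_two, Matrix.one_fin_two]; simp,
    by rw [Matrix.mul_fin_two, Matrix.one_fin_two]; simp⟩, k, P, rfl⟩

theorem coe_affine (k : ι → ℤ) (P : CoeffRing l) :
    ((affine l k P : GL (Fin 2) (CoeffRing l)) : Matrix (Fin 2) (Fin 2) (CoeffRing l)) =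
      !![(linMonomial l k : CoeffRing l), P; 0, 1] :=
  rfl

theorem exists_eq_affine (g : matrixGroup l) : ∃ k P, g = affine l k P := by
  obtain ⟨g, k, P, h⟩ := g
  exact ⟨k, P, Subtype.ext (Units.ext h)⟩

theorem affine_mul (k m : ι → ℤ) (P Q : CoeffRing l) :
    affine l k P * affine l m Q = affine l (k + m) (linMonomial l k * Q + P) := by
  refine Subtype.ext (Units.ext ?_)
  rw [Subgroup.coe_mul, Units.val_mul, coe_affine, coe_affine, coe_affine, linMonomial_add,
    Matrix.mul_fin_two]
  simp

theorem affine_zero_zero : affine l 0 0 = 1 := by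
  refine Subtype.ext (Units.ext ?_)
  rw [coe_affine, linMonomial_zero]
  simp [Matrix.one_fin_two]

variable {l}

theorem affine_injective (hinj : Function.Injective (linMonomial l)) {k m : ι → ℤ}
    {P Q : CoeffRing l} (h : affine l k P = affine l m Q) : k = m ∧ P = Q := by
  have h' := congrArg (fun g : matrixGroup l =>
    ((g : GL (Fin 2) (CoeffRing l)) : Matrix (Fin 2) (Fin 2) (CoeffRing l))) h
  simp only [coe_affine] at h'
  have h00 := congrFun (congrFun h' 0) 0
  have h01 := congrFun (congrFun h' 0) 1
  exact ⟨hinj (Units.ext (by simpa using h00)), by simpa using h01⟩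

theorem exists_exponent (hinj : Function.Injective (linMonomial l)) :
    ∃ E : matrixGroup l →* Multiplicative (ι → ℤ), ∀ k P, E (affine l k P) = .ofAdd k := by
  choose e P he using exists_eq_affine l
  have hE : ∀ k Q, e (affine l k Q) = k := fun k Q => (affine_injective hinj (he _)).1.symm
  refine ⟨MonoidHom.mk' (fun g => .ofAdd (e g)) fun a b => ?_, fun k Q =>
    congrArg Multiplicative.ofAdd (hE k Q)⟩
  rw [he a, he b, affine_mul, hE, hE, hE, ofAdd_add]

theorem affine_zero_pow (P : CoeffRing l) (n : ℕ) : affine l 0 P ^ n = affine l 0 (n * P) := by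
  induction n with
  | zero => simp [affine_zero_zero]
  | succ n ih =>
    rw [pow_succ, ih, affine_mul, linMonomial_zero, add_zero]
    congr 1
    push_cast
    ring

/-- An automorphism of the group of matrices `[∏ i, (t + l i) ^ (k i), P; 0, 1]` preserves the
unipotent matrices, acts on the exponents `k` by an additive map `A`, and acts on the entries `P`
of the unipotent matrices by a ring endomorphism `ψ` followed by multiplication by a unit `c`. -/
theorem exists_semilinear (hinj : Function.Injective (linMonomial l))
    (hL : Function.Surjective (Int.cast : ℤ → L)) {n : ℕ} (hn : n ≠ 0) (hnL : (n : L) = 0)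
    (i₀ : ι) (h₀ : l i₀ = 0) (φ : MulAut (matrixGroup l)) :
    ∃ (A : (ι → ℤ) →+ (ι → ℤ)) (ψ : CoeffRing l →+* CoeffRing l) (c : (CoeffRing l)ˣ),
      Function.Surjective A ∧ (∀ k, ψ (linMonomial l k) = linMonomial l (A k)) ∧
      (∀ k P, ∃ Q, φ (affine l k P) = affine l (A k) Q) ∧
      ∀ P, φ (affine l 0 P) = affine l 0 (ψ P * c) := by
  obtain ⟨E, hE⟩ := exists_exponent hinj
  have hnR : (n : CoeffRing l) = 0 := by
    have := congrArg (fun a => algebraMap L[X] (CoeffRing l) (C a)) hnL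
    simpa using this
  have hunip : ∀ (θ : MulAut (matrixGroup l)) P, ∃ Q, θ (affine l 0 P) = affine l 0 Q := by
    intro θ P
    obtain ⟨k, Q, h⟩ := exists_eq_affine l (θ (affine l 0 P))
    -- Unipotent matrices are killed by `n`, while the exponent lattice is torsion-free.
    have h1 : θ (affine l 0 P) ^ n = 1 := by
      rw [← map_pow, affine_zero_pow, hnR, zero_mul, affine_zero_zero, map_one]
    have h2 : n • k = 0 := by
      have := congrArg E h1
      rw [map_pow, h, hE, map_one] at this
      exact this
    have h3 : k = 0 := (smul_eq_zero.1 h2).resolve_left hn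
    exact ⟨Q, by rw [h, h3]⟩
  choose F hF using hunip φ
  choose F' hF' using hunip φ⁻¹
  have hFadd : ∀ P Q, F (P + Q) = F P + F Q := by
    intro P Q
    have h := hF (Q + P)
    have hmul : affine l 0 (Q + P) = affine l 0 P * affine l 0 Q := by
      rw [affine_mul, linMonomial_zero]
      simp
    rw [hmul, map_mul, hF, hF, affine_mul, linMonomial_zero] at h
    have := (affine_injective hinj h).2
    rw [add_comm P Q, ← this]
    simp [add_comm]
  have hFsurj : Function.Surjective F := by
    intro P
    have h := hF (F' P)
    rw [← hF' P, MulAut.apply_inv_self] at h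
    exact ⟨F' P, (affine_injective hinj h).2.symm⟩
  choose A B hAB using fun k => exists_eq_affine l (φ (affine l k 0))
  have hA : ∀ k P, ∃ Q, φ (affine l k P) = affine l (A k) Q := by
    intro k P
    have : affine l k P = affine l 0 P * affine l k 0 := by
      rw [affine_mul, linMonomial_zero]
      simp
    rw [this, map_mul, hF, hAB, affine_mul, zero_add]
    exact ⟨_, rfl⟩
  have hAadd : ∀ k m, A (k + m) = A k + A m := by
    intro k m
    have h := hAB (k + m)
    have hmul : affine l (k + m) 0 = affine l k 0 * affine l m 0 := by
      rw [affine_mul]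
      simp
    rw [hmul, map_mul, hAB, hAB, affine_mul] at h
    exact (affine_injective hinj h).1.symm
  have hAsurj : Function.Surjective A := by
    intro k
    obtain ⟨m, P, h⟩ := exists_eq_affine l (φ⁻¹ (affine l k 0))
    obtain ⟨Q, hQ⟩ := hA m P
    refine ⟨m, ?_⟩
    rw [← h, MulAut.apply_inv_self] at hQ
    exact (affine_injective hinj hQ).1.symm
  -- Conjugating a unipotent matrix by a diagonal one multiplies its entry by a monomial; `φ`
  -- respects this.
  have hFmul : ∀ k P, F (linMonomial l k * P) = linMonomial l (A k) * F P := by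
    intro k P
    have h : affine l k 0 * affine l 0 P = affine l 0 (linMonomial l k * P) * affine l k 0 := by
      simp [affine_mul, linMonomial_zero]
    have h' := congrArg φ h
    rw [map_mul, map_mul, hAB, hF, hF, affine_mul, affine_mul, linMonomial_zero] at h'
    have := (affine_injective hinj h').2
    rw [add_comm, Units.val_one, one_mul] at this
    exact (add_left_cancel this).symm
  have hF0 : F 0 = 0 := by simpa using hFadd 0 0
  have hFneg : ∀ P, F (-P) = -F P := fun P => by
    rw [eq_neg_iff_add_eq_zero, ← hFadd, neg_add_cancel, hF0]
  -- Monomials span additively, so `F 1` divides every value of `F`; as `F` is onto, it divides 1.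
  have hFone : IsUnit (F 1) := by
    have hdvd : ∀ P, F 1 ∣ F P := by
      refine fun P => linMonomial_induction l hL i₀ h₀ (p := fun P => F 1 ∣ F P) (fun k => ?_)
        (by rw [hF0]; exact dvd_zero _) (fun x y hx hy => by rw [hFadd]; exact dvd_add hx hy)
        (fun x hx => by rw [hFneg]; exact (dvd_neg).2 hx) P
      have := hFmul k 1
      rw [mul_one] at this
      exact this ▸ dvd_mul_left _ _
    obtain ⟨P, hP⟩ := hFsurj 1
    exact isUnit_of_dvd_one (hP ▸ hdvd P)
  obtain ⟨c, hc⟩ := hFone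
  have hψ : ∀ k x, F (linMonomial l k * x) * (c⁻¹ : (CoeffRing l)ˣ) =
      F (linMonomial l k) * (c⁻¹ : (CoeffRing l)ˣ) * (F x * (c⁻¹ : (CoeffRing l)ˣ)) := by
    intro k x
    have h1 := hFmul k 1
    rw [mul_one, ← hc] at h1
    rw [hFmul, h1, Units.mul_inv_cancel_right, mul_assoc]
  let ψ : CoeffRing l →+* CoeffRing l :=
    { toFun := fun x => F x * (c⁻¹ : (CoeffRing l)ˣ)
      map_one' := by rw [← hc, Units.mul_inv]
      map_zero' := by rw [hF0, zero_mul]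
      map_add' := fun x y => by rw [hFadd, add_mul]
      map_mul' := fun x y => by
        refine linMonomial_induction l hL i₀ h₀ (p := fun x => F (x * y) * (c⁻¹ : (CoeffRing l)ˣ) =
          F x * (c⁻¹ : (CoeffRing l)ˣ) * (F y * (c⁻¹ : (CoeffRing l)ˣ)))
          (fun k => hψ k y) ?_ ?_ ?_ x
        · simp [hF0]
        · intro a b ha hb
          rw [add_mul, hFadd, add_mul, ha, hb, hFadd]
          ring
        · intro a ha
          rw [neg_mul, hFneg, neg_mul, ha, hFneg]
          ring }
  refine ⟨AddMonoidHom.mk' A hAadd, ψ, c, hAsurj, fun k => ?_, hA, fun P => ?_⟩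
  · change F _ * _ = _
    have h1 := hFmul k 1
    rw [mul_one, ← hc] at h1
    rw [h1, Units.mul_inv_cancel_right]
    rfl
  · change _ = affine l 0 (F P * _ * c)
    rw [hF, Units.inv_mul_cancel_right]

/-- A nonzero linear functional on the exponents that is invariant under `φ` separates infinitely
many `φ`-twisted conjugacy classes. -/
theorem infinite_of_invariant (hinj : Function.Injective (linMonomial l))
    {φ : MulAut (matrixGroup l)} {A : (ι → ℤ) →+ (ι → ℤ)}
    (hA : ∀ k P, ∃ Q, φ (affine l k P) = affine l (A k) Q) (f : (ι → ℤ) →+ ℤ)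
    (hf : ∀ k, f (A k) = f k) (hsurj : Function.Surjective f) :
    Infinite (Quotient (twistedConj φ)) := by
  obtain ⟨E, hE⟩ := exists_exponent hinj
  have hEφ : ∀ g, f (E (φ g)).toAdd = f (E g).toAdd := by
    intro g
    obtain ⟨k, P, rfl⟩ := exists_eq_affine l g
    obtain ⟨Q, hQ⟩ := hA k P
    rw [hQ, hE, hE]
    exact hf k
  refine Infinite.of_surjective (Quotient.lift (fun g => f (E g).toAdd) ?_) ?_
  · rintro g h ⟨s, rfl⟩
    simp [hEφ]
  · intro n
    obtain ⟨k, rfl⟩ := hsurj n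
    exact ⟨Quotient.mk _ (affine l k 0), by simp [hE]⟩

end MatrixGroup

theorem map_algebraMap_C {L : Type*} [CommRing L] {ι : Type*} {l : ι → L}
    (hL : Function.Surjective (Int.cast : ℤ → L))
    (ψ : CoeffRing l →+* CoeffRing l) (a : L) :
    ψ (algebraMap L[X] (CoeffRing l) (C a)) = algebraMap L[X] (CoeffRing l) (C a) := by
  obtain ⟨n, rfl⟩ := hL a
  simp

/-! ### The possible actions on exponents. -/

section ExponentMap

variable {L : Type*} [CommRing L] {ι : Type*} [Fintype ι] {l : ι → L}

theorem apply_eq_sum_single [DecidableEq ι] (A : (ι → ℤ) →+ (ι → ℤ)) (k : ι → ℤ) (m : ι) :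
    A k m = ∑ i, k i * A (Pi.single i 1) m := by
  have hk : k = ∑ i, k i • Pi.single i (1 : ℤ) := by
    simpa using pi_eq_sum_univ' k
  conv_lhs => rw [hk]
  simp only [map_sum, map_zsmul, Finset.sum_apply, Pi.smul_apply, smul_eq_mul]

/-- A surjective endomorphism of the group of exponents that is induced by a ring endomorphism
permutes the `card ι + 1` coordinate functionals `k i` and `-∑ i, k i`, up to omitting one. -/
theorem exists_column_type {K : Type*} [Field K] (h : L →+* K)
    (hl : ∀ i j, i ≠ j → h (l i) ≠ h (l j)) (hL : Function.Surjective (Int.cast : ℤ → L))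
    {A : (ι → ℤ) →+ (ι → ℤ)} (hA : Function.Surjective A) {ψ : CoeffRing l →+* CoeffRing l}
    (hψ : ∀ k, ψ (linMonomial l k) = linMonomial l (A k)) :
    ∃ T : ι → Option ι, Function.Injective T ∧ (∀ m, T m = none → ∀ k, A k m = -∑ i, k i) ∧
      ∀ m i, T m = some i → ∀ k, A k m = k i := by
  classical
  have key : ∀ m, ∃ t : Option ι, (t = none → ∀ k, A k m = -∑ i, k i) ∧
      ∀ i, t = some i → ∀ k, A k m = k i := by
    intro m
    obtain ⟨v, hv, hvC⟩ := exists_addValuation l h hl m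
    obtain ⟨k₁, hk₁⟩ := hA (Pi.single m 1)
    have hone : A k₁ m = 1 := by rw [hk₁, Pi.single_eq_same]
    set a : ι → ℤ := fun i => A (Pi.single i 1) m with ha
    have hsum : ∀ k, A k m = ∑ i, k i * a i := fun k => apply_eq_sum_single A k m
    have hva : ∀ i, v (ψ (lin l i)) = (a i : WithTop ℤ) := by
      intro i
      have := hψ (Pi.single i 1)
      rw [linMonomial_single, zpow_one] at this
      rw [this, hv]
    -- The difference is the constant `l i - l j`, nonzero in the residue field. By the ultrametric
    -- inequality, two distinct values among the `a i` have minimum 0, and two equal ones are at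
    -- most 0.
    have hsub : ∀ i j, i ≠ j → v (ψ (lin l i) - ψ (lin l j)) = (0 : ℤ) := by
      intro i j hij
      rw [← map_sub, lin_sub_lin, map_algebraMap_C hL]
      apply hvC
      rw [map_sub, sub_ne_zero]
      exact hl i j hij
    have hmin : ∀ i j, i ≠ j → min (a i) (a j) ≤ 0 := by
      intro i j hij
      have := v.map_sub (ψ (lin l i)) (ψ (lin l j))
      rw [hsub i j hij, hva, hva] at this
      exact_mod_cast this
    have hlt : ∀ i j, a i < a j → a i = 0 := by
      intro i j hij
      have hne : i ≠ j := by
        rintro rfl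
        exact lt_irrefl _ hij
      have := hsub i j hne
      rw [sub_eq_add_neg, AddValuation.map_add_eq_of_lt_left, hva] at this
      · exact_mod_cast this
      · rw [AddValuation.map_neg, hva, hva]
        exact_mod_cast hij
    by_cases hneg : ∃ i, a i < 0
    · obtain ⟨i, hi⟩ := hneg
      have hall : ∀ j, a j = a i := by
        intro j
        rcases lt_trichotomy (a i) (a j) with h1 | h1 | h1
        · exact absurd (hlt _ _ h1) hi.ne
        · exact h1.symm
        · exact absurd (hlt _ _ h1) (h1.trans hi).ne
      have hsum' : ∀ k, A k m = (∑ j, k j) * a i := fun k => by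
        rw [hsum, Finset.sum_mul]
        exact Finset.sum_congr rfl fun j _ => by rw [hall]
      -- Surjectivity of `A` makes 1 a multiple of `a i`, and `a i` is negative here.
      have hai : a i = -1 := by
        rw [hsum'] at hone
        rcases Int.isUnit_iff.1 (IsUnit.of_mul_eq_one_right _ hone) with h1 | h1
        · omega
        · exact h1
      exact ⟨none, fun _ k => by rw [hsum', hai]; ring,
        fun i hi => absurd hi (Option.some_ne_none i).symm⟩
    · push Not at hneg
      have hpos : ∃ i, 0 < a i := by
        by_contra! hle
        rw [hsum, Finset.sum_eq_zero fun i _ => by rw [le_antisymm (hle i) (hneg i), mul_zero]]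
          at hone
        exact zero_ne_one hone
      obtain ⟨i, hi⟩ := hpos
      have hsum' : ∀ k, A k m = k i * a i := fun k => by
        rw [hsum, Finset.sum_eq_single i]
        · intro j _ hj
          have h1 := hmin j i hj
          have h2 := hneg j
          have : a j = 0 := by omega
          rw [this, mul_zero]
        · simp
      have hai : a i = 1 := by
        rw [hsum'] at hone
        rcases Int.isUnit_iff.1 (IsUnit.of_mul_eq_one_right _ hone) with h1 | h1
        · exact h1
        · omega
      refine ⟨some i, fun h => absurd h (Option.some_ne_none i), fun j hj k => ?_⟩
      obtain rfl := Option.some_injective _ hj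
      rw [hsum', hai, mul_one]
  choose T hT₁ hT₂ using key
  refine ⟨T, fun m m' hm => ?_, hT₁, hT₂⟩
  have heq : ∀ k, A k m = A k m' := by
    intro k
    cases ht : T m with
    | none => rw [hT₁ m ht, hT₁ m' (hm ▸ ht)]
    | some i => rw [hT₂ m i ht, hT₂ m' i (hm ▸ ht)]
  obtain ⟨k, hk⟩ := hA (Pi.single m 1)
  by_contra hne
  have := heq k
  rw [hk, Pi.single_eq_same, Pi.single_eq_of_ne (Ne.symm hne)] at this
  exact one_ne_zero this

end ExponentMap

/-! ### The exceptional case of an order-three action. -/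

section OrderThree

variable {K : Type*} [Field K] {ι : Type*} [Fintype ι] {l : ι → K}

/-- Over the field with two elements, an automorphism that permutes `0`, `1` and `∞` cyclically
has infinitely many twisted conjugacy classes. -/
theorem infinite_of_order_three (hl : Function.Injective l) (hK : ∀ a : K, a ≠ 0 → a = 1)
    (h2 : (2 : K) = 0) (hK' : Function.Surjective (Int.cast : ℤ → K)) {i₀ : ι} (h₀ : l i₀ = 0)
    {i j : ι} (hij : i ≠ j) (hι : ∀ m, m = i ∨ m = j) {φ : MulAut (matrixGroup l)}
    {A : (ι → ℤ) →+ (ι → ℤ)} {ψ : CoeffRing l →+* CoeffRing l} {c : (CoeffRing l)ˣ}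
    (hψ : ∀ k, ψ (linMonomial l k) = linMonomial l (A k))
    (hA : ∀ k P, ∃ Q, φ (affine l k P) = affine l (A k) Q)
    (hφ : ∀ P, φ (affine l 0 P) = affine l 0 (ψ P * c))
    (hAi : ∀ k, A k i = k j) (hAj : ∀ k, A k j = -(k i + k j)) :
    Infinite (Quotient (twistedConj φ)) := by
  classical
  have hl' : ∀ i j, i ≠ j → RingHom.id K (l i) ≠ RingHom.id K (l j) := fun i j h => hl.ne h
  have hinj := linMonomial_injective l (RingHom.id K) hl'
  have hR2 : (2 : CoeffRing l) = 0 := by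
    rw [← map_ofNat (algebraMap K[X] (CoeffRing l)), ← map_ofNat (C : K →+* K[X]), h2, map_zero,
      map_zero]
  have hext : ∀ k k' : ι → ℤ, k i = k' i → k j = k' j → k = k' := by
    intro k k' h1 h2
    funext m
    rcases hι m with rfl | rfl <;> assumption
  have hA3 : ∀ k, A (A (A k)) = k := fun k =>
    hext _ _ (by simp only [hAi, hAj]; ring) (by simp only [hAi, hAj]; ring)
  have hAfix : ∀ k, A k = k → k = 0 := by
    intro k hk
    have h1 := hAi k
    have h2 := hAj k
    rw [hk] at h1 h2
    exact hext _ _ (by simp; omega) (by simp; omega)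
  have hψ3 : ∀ x, ψ (ψ (ψ x)) = x :=
    linMonomial_induction l hK' i₀ h₀ (fun k => by rw [hψ, hψ, hψ, hA3]) (by simp)
      (fun x y hx hy => by simp only [map_add, hx, hy]) (fun x hx => by simp only [map_neg, hx])
  -- Diagonal part `c⁻¹` cancels the factor `c` in `φ`.
  obtain ⟨k₀, hk₀⟩ := exists_linMonomial_eq_unit l hK c⁻¹
  have hclass : ∀ x y, ψ x = x → ψ y = y →
      twistedConj φ (affine l k₀ x) (affine l k₀ y) → x = y := by
    rintro x y hx hy ⟨s, hs⟩
    obtain ⟨k, Q, rfl⟩ := exists_eq_affine l s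
    obtain ⟨Q', hQ'⟩ := hA k Q
    -- Comparing exponents gives `A k = k`, so the conjugating element is unipotent.
    have hk : k = 0 := by
      rw [mul_inv_eq_iff_eq_mul, hQ', affine_mul, affine_mul] at hs
      have := (affine_injective hinj hs).1
      rw [add_comm] at this
      exact hAfix k (add_left_cancel this).symm
    subst hk
    rw [mul_inv_eq_iff_eq_mul, hφ, affine_mul, affine_mul, hk₀, linMonomial_zero] at hs
    have h1 := (affine_injective hinj hs).2
    rw [Units.val_one, one_mul, mul_comm (ψ Q), Units.inv_mul_cancel_left] at h1
    have h2 := congrArg ψ h1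
    rw [map_add, map_add, hx, hy] at h2
    have h3 := congrArg ψ h2
    rw [map_add, map_add, hx, hy, hψ3] at h3
    -- The relation is `x + Q = ψ Q + y`. Adding its images under `ψ` and `ψ²` cancels all terms in
    -- `Q`, leaving `3 * x = 3 * y`, which is `x = y` in characteristic 2.
    linear_combination h1 + h2 + h3 - (x - y) * hR2
  -- Orbit sums under `ψ`; the three terms have valuations `n + 1`, `0` and `-(n + 1)` at the root
  -- of `t + l i`, so the pole order recovers `n`.
  let x : ℕ → CoeffRing l := fun n =>
    linMonomial l (Pi.single i (n + 1 : ℤ)) + linMonomial l (A (Pi.single i (n + 1 : ℤ))) +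
      linMonomial l (A (A (Pi.single i (n + 1 : ℤ))))
  have hxfix : ∀ n, ψ (x n) = x n := by
    intro n
    simp only [x, map_add, hψ, hA3]
    ring
  obtain ⟨v, hv, -⟩ := exists_addValuation l (RingHom.id K) hl' i
  have hxv : ∀ n, v (x n) = ((-(n + 1 : ℤ) : ℤ) : WithTop ℤ) := by
    intro n
    have v1 := hv (Pi.single i (n + 1 : ℤ))
    have v2 := hv (A (Pi.single i (n + 1 : ℤ)))
    have v3 := hv (A (A (Pi.single i (n + 1 : ℤ))))
    rw [Pi.single_eq_same] at v1
    rw [hAi, Pi.single_eq_of_ne hij.symm] at v2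
    rw [hAi, hAj, Pi.single_eq_same, Pi.single_eq_of_ne hij.symm, add_zero] at v3
    have v12 : v ((linMonomial l (Pi.single i (n + 1 : ℤ)) : CoeffRing l) +
        linMonomial l (A (Pi.single i (n + 1 : ℤ)))) = (0 : ℤ) := by
      rw [AddValuation.map_add_eq_of_lt_right, v2]
      rw [v1, v2]
      exact WithTop.coe_lt_coe.2 (by omega)
    rw [AddValuation.map_add_eq_of_lt_right, v3]
    rw [v12, v3]
    exact WithTop.coe_lt_coe.2 (by omega)
  refine Infinite.of_injective (fun n => Quotient.mk (twistedConj φ) (affine l k₀ (x n))) ?_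
  intro n n' h
  have h1 := congrArg v (hclass _ _ (hxfix n) (hxfix n') (Quotient.exact h))
  rw [hxv, hxv] at h1
  have := WithTop.coe_injective h1
  omega

end OrderThree

/-! ### Case analysis on the action on exponents. -/

section Main

variable {ι : Type*} [Fintype ι] [Nontrivial ι]

theorem propertyRInf_matrixGroup {q : ℕ} (hq : 2 ≤ q) (l : ι → ZMod q) (i₀ : ι) (h₀ : l i₀ = 0)
    (hl : ∀ i j, i ≠ j → IsUnit (l i - l j)) : PropertyRInf (matrixGroup l) := by
  classical
  intro φ
  obtain ⟨p, hp, hpq⟩ := Nat.exists_prime_and_dvd (by omega : q ≠ 1)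
  have : Fact p.Prime := ⟨hp⟩
  have : Nontrivial (ZMod q) := ZMod.nontrivial_iff.2 (by omega)
  have hL : Function.Surjective (Int.cast : ℤ → ZMod q) := ZMod.intCast_surjective
  set h := ZMod.castHom hpq (ZMod p)
  have hlp : ∀ i j, i ≠ j → h (l i) ≠ h (l j) := fun i j hij => by
    rw [← sub_ne_zero, ← map_sub]
    exact ((hl i j hij).map h).ne_zero
  have hinj := linMonomial_injective l h hlp
  obtain ⟨A, ψ, c, hAsurj, hψ, hA, hφ⟩ :=
    exists_semilinear hinj hL (by omega : q ≠ 0) (ZMod.natCast_self q) i₀ h₀ φ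
  obtain ⟨T, hT, hTnone, hTsome⟩ := exists_column_type h hlp hL hAsurj hψ
  by_cases hnone : ∃ j, T j = none
  swap
  · have : ∀ m, ∃ i, T m = some i := fun m => Option.ne_none_iff_exists'.1 fun h => hnone ⟨m, h⟩
    choose σ hσ using this
    have hσinj : Function.Injective σ := fun m m' hm => hT (by rw [hσ, hσ, hm])
    refine infinite_of_invariant hinj hA (∑ m, Pi.evalAddMonoidHom (fun _ => ℤ) m) (fun k => ?_)
      fun n => ⟨Pi.single i₀ n, by simp⟩
    simp only [AddMonoidHom.finsetSum_apply, Pi.evalAddMonoidHom_apply]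
    rw [← (Finite.injective_iff_bijective.1 hσinj).sum_comp k]
    exact Finset.sum_congr rfl fun m _ => hTsome m _ (hσ m) k
  by_cases hfix : ∃ m, T m = some m
  · obtain ⟨m, hm⟩ := hfix
    exact infinite_of_invariant hinj hA (Pi.evalAddMonoidHom (fun _ => ℤ) m) (hTsome m m hm)
      fun n => ⟨Pi.single m n, by simp⟩
  obtain ⟨j, hj⟩ := hnone
  obtain ⟨i, hi⟩ : ∃ i, ∀ m, T m ≠ some i := by
    by_contra! hall
    have hsurj : Function.Surjective T := fun t => by
      cases t with
      | none => exact ⟨j, hj⟩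
      | some i => exact hall i
    have := Fintype.card_of_bijective ⟨hT, hsurj⟩
    rw [Fintype.card_option] at this
    omega
  -- Sending `j` to the omitted index `i` turns `T` into a permutation of `ι`.
  have hgsurj : Function.Surjective fun m => (T m).getD i := by
    refine Finite.injective_iff_surjective.1 fun m m' hm => hT ?_
    have := hi m
    have := hi m'
    cases h1 : T m <;> cases h2 : T m' <;> simp_all
  have hAsingle : ∀ m k, (∀ m', A k m' = (Pi.single m 1 - Pi.single j 1 : ι → ℤ) m') →
      ψ (linMonomial l k) * lin l j = lin l m := by
    intro m k hk
    rw [hψ, funext hk, sub_eq_add_neg, linMonomial_add, linMonomial_neg, linMonomial_single,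
      linMonomial_single, zpow_one, zpow_one, Units.val_mul, Units.inv_mul_cancel_right]
  have hψi : ψ (lin l i) * lin l j = 1 := by
    have hAi : A (Pi.single i 1) = -Pi.single j 1 := by
      funext m
      cases ht : T m with
      | none =>
        obtain rfl := hT (ht.trans hj.symm)
        rw [hTnone m ht]
        simp
      | some i' =>
        have h1 : i' ≠ i := fun h => hi m (h ▸ ht)
        have h2 : m ≠ j := by
          rintro rfl
          rw [hj] at ht
          cases ht
        rw [hTsome m i' ht]
        simp [h1, h2]
    have := hψ (Pi.single i 1)
    rw [hAi, linMonomial_neg, linMonomial_single, linMonomial_single, zpow_one, zpow_one] at this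
    rw [this, Units.inv_mul]
  -- Here `ψ (t + l i) = (t + l j)⁻¹` and `ψ (t + l i') = (t + l m) / (t + l j)`. Their difference
  -- is the constant `l i' - l i`, whence `(t + l m) - 1 = (l i' - l i) * (t + l j)`; compare
  -- coefficients.
  have hrel : ∀ i', i' ≠ i → ∃ m, T m = some i' ∧ l i' - l i = 1 ∧ l m - 1 = l j := by
    intro i' hi'
    obtain ⟨m, hm⟩ := hgsurj i'
    have hm' : T m = some i' := by
      cases ht : T m with
      | none => simp [ht] at hm; exact absurd hm.symm hi'
      | some a => simp [ht] at hm; rw [hm]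
    have hmj : m ≠ j := by
      rintro rfl
      rw [hj] at hm'
      cases hm'
    have h1 : ψ (lin l i') * lin l j = lin l m := by
      have := hAsingle m (Pi.single i' 1) fun m' => ?_
      · rwa [linMonomial_single, zpow_one] at this
      cases ht : T m' with
      | none =>
        obtain rfl := hT (ht.trans hj.symm)
        rw [hTnone m' ht]
        simp [hmj.symm]
      | some a =>
        have h2 : m' ≠ j := by
          rintro rfl
          rw [hj] at ht
          cases ht
        rw [hTsome m' a ht]
        by_cases hmm : m' = m
        · subst hmm
          obtain rfl : a = i' := by simpa [ht] using hm'
          simp [h2]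
        · have h3 : a ≠ i' := fun h => hmm (hT (by rw [ht, hm', h]))
          simp [h2, h3, hmm]
    have h2 : (lin l m : CoeffRing l) - 1 =
        algebraMap (ZMod q)[X] (CoeffRing l) (C (l i' - l i)) * lin l j := by
      rw [← map_algebraMap_C hL ψ, ← lin_sub_lin, map_sub, sub_mul, h1, hψi]
    rw [coe_lin, coe_lin, ← map_one (algebraMap (ZMod q)[X] (CoeffRing l)), ← map_sub,
      ← map_mul] at h2
    have h3 := algebraMap_injective l h2
    have c1 := congrArg (fun f => f.coeff 1) h3
    have c0 := congrArg (fun f => f.coeff 0) h3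
    simp only [coeff_C_mul, coeff_add, coeff_sub, coeff_X_one, coeff_X_zero, coeff_one,
      coeff_C_zero, coeff_C_succ, one_ne_zero, if_false, if_true] at c1 c0
    simp only [add_zero, sub_zero, zero_add, mul_one] at c1 c0
    exact ⟨m, hm', c1.symm, by rw [c0, ← c1, one_mul]⟩
  obtain ⟨i', hi'⟩ := exists_ne i
  obtain ⟨m, hm, hd, hlm⟩ := hrel i' hi'
  -- Every parameter other than `l i` equals `l i + 1`, so there is only one.
  have hι : ∀ a, a = i ∨ a = i' := by
    intro a
    by_contra! ha
    obtain ⟨-, -, hd', -⟩ := hrel a ha.1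
    exact hlp a i' ha.2 (by rw [sub_left_injective (hd'.trans hd.symm)])
  have hmi : m = i := (hι m).resolve_right fun h => hfix ⟨m, h ▸ hm⟩
  have hmj : m ≠ j := by
    rintro rfl
    rw [hj] at hm
    cases hm
  have hji : j = i' := (hι j).resolve_left fun h => hmj (hmi.trans h.symm)
  subst hmi hji
  have h2 : (2 : ZMod q) = 0 := by linear_combination -(hd + hlm)
  have hq2 : q = 2 := by
    have : q ∣ 2 := (ZMod.natCast_eq_zero_iff 2 q).1 (by exact_mod_cast h2)
    exact le_antisymm (Nat.le_of_dvd two_pos this) hq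
  subst hq2
  refine infinite_of_order_three (fun a b hab => ?_) (by decide) h2 hL h₀ hi'.symm hι hψ hA hφ
    (hTsome _ _ hm) fun k => ?_
  · by_contra hne
    exact hlp a b hne (by rw [hab])
  · rw [hTnone j hj]
    congr 1
    rw [← Finset.sum_pair hi'.symm]
    refine (Finset.sum_subset (Finset.subset_univ _) fun a _ ha => ?_).symm
    rcases hι a with rfl | rfl <;> simp at ha

end Main

end DiestelLeader

theorem theorem4p3 (d q : ℕ) (hd : 3 ≤ d) (hq : 2 ≤ q) (l : Fin (d - 1) → ZMod q)
    (hl_zero : l ⟨0, by omega⟩ = 0)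
    (hl_unit : ∀ i j : Fin (d - 1), i ≠ j → IsUnit (l i - l j)) :
    DiestelLeader.PropertyRInf (DiestelLeader.Gam d q l) := by
  have : Nontrivial (Fin (d - 1)) := Fin.nontrivial_iff_two_le.2 (by omega)
  exact DiestelLeader.propertyRInf_matrixGroup hq l _ hl_zero hl_unit
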